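/- **Setting.** Let $n,k,b$ be positive integers. Node $i\in\{1,\dots,n\}$ has $b_i\ge 1$ processors and carries a binary $bk\times b_i$ generator matrix $G_i$; every column of $G_i$ is a coded symbol (one for each processor), i.e. a sum of some of the $bk$ information symbols, which are the $bk$ dot products to be computed. Put $b'=\frac1n\sum_i b_i$ and assume $b'>b$. Assume that all $bk$ information symbols can be recovered from the coded symbols of any $k$ of the $n$ nodes by belief propagation: coded symbols are processed one after the other, each having at most one still unknown information symbol when it is processed (which becomes known), at most $kb'$ distinct coded symbols being used. Each processor of node $i$ performs at most $\sigma_i\ge1$ dot products, and at least as many as the degree of its coded symbol; $\sigma=\max_i\sigma_i$. **Latency.** The time of a dot product on a node processor is exponential with rate $\mu>0$, independently over the processors; a processor performing $w$ dot products needs $w$ times such a time. A node finishes when all of its processors have finished, and the parallel task time is the time at which $k$ nodes have finished. Encoding costs nothing at the master. Let $W$ be the worst-case (over the sets of $k$ nodes and over the belief propagation runs on them) total number of dot products in the coded symbols processed by the decoder. The work $W$ is split evenly over the $p$ processors of the master, each needing $W/p$ times an exponential time of rate $c\mu$ ($c>0$), independently, and all have to finish. $T$ is the sum of the parallel task time and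 the decoding time. **Theorem.** Let $n=(1+\delta)k$ with $\delta>0$, let $x_i=\sigma_i\log b_i$, and let $$A=\frac{\sigma k b'}{cp\mu}\log p,\qquad B=\frac{\sigma}{\mu}\log b'+\overline{\sigma}_b\sqrt{2\log\Big(\frac{1+\delta}{\delta}\Big)},$$ $$\overline{\sigma}_b=\frac1\mu\sqrt{\frac{n(\max_i x_i-\min_i x_i)^2}{4}+\frac1n\sum_{i=1}^n b_i^{2(\sigma_i-1)}}.$$ For fixed $\delta$ and $\sigma$, the expectation $\mathbb E[T]$ is finite and asymptotically at most $A+B$ as $k\to\infty$, for large $p$. Precisely: for every $\varepsilon>0$ there is $P=P(\varepsilon)$ such that for all $\delta>0$ and $\sigma$ there is $K=K(\varepsilon,\delta,\sigma)$ such that, for all $k\ge K$, all $p\ge P$ and all $b$, $b_i$, $\sigma_i$, $c$, $\mu$ and codes as above, $$\mathbb E[T]\le(1+\varepsilon)(A+B),$$ and if $\sigma\ge2$ then even $\mathbb E[T]\le(1+\varepsilon)A+B$. -/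

import Mathlib

open MeasureTheory ProbabilityTheory

/-- A binary linear array code on `n` nodes for the `b * k` information symbols (the entries of the
matrix product): node `i` carries the `size i` coded symbols `(y_{i,1}, …) = (x_1, …, x_{bk}) G_i`,
one for each of its processors, where `G_i = gen i` is a `bk × size i` matrix over the field with
two elements. -/
structure ArrayCode (n k b : ℕ) where
  /-- the number `b_i` of processors (coded symbols) of node `i` -/
  size : Fin n → ℕ
  /-- the generator matrix `G_i` of node `i` -/
  gen : (i : Fin n) → Matrix (Fin (b * k)) (Fin (size i)) (ZMod 2)

namespace ArrayCode

variable {n k b : ℕ}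

/-- The coded symbols, equivalently the processors of all nodes. -/
abbrev Symbol (C : ArrayCode n k b) : Type := Σ i : Fin n, Fin (C.size i)

/-- `b' = (1/n) ∑ b_i`. -/
noncomputable def avgSize (C : ArrayCode n k b) : ℝ := (∑ i, (C.size i : ℝ)) / n

/-- The information symbols (dot products) that are added up in a coded symbol. -/
def support (C : ArrayCode n k b) (s : C.Symbol) : Finset (Fin (b * k)) :=
  Finset.univ.filter fun v => C.gen s.1 v s.2 ≠ 0

/-- The degree of a coded symbol. -/
def degree (C : ArrayCode n k b) (s : C.Symbol) : ℕ := (C.support s).card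

/-- Belief propagation (peeling) over the binary field, started from the set `R` of information
symbols that are already known: the coded symbols in the list are processed one after the other,
each of them has at most one unknown information symbol when its turn comes (which then becomes
known), and at the end all information symbols are known. -/
def Peels (C : ArrayCode n k b) : Finset (Fin (b * k)) → List C.Symbol → Prop
  | R, [] => R = Finset.univ
  | R, s :: l => (C.support s \ R).card ≤ 1 ∧ C.Peels (R ∪ C.support s) l

/-- `l` is a run of the belief propagation decoder on the nodes in `S`: it processes pairwise
distinct coded symbols of these nodes, at most `k b' = (1 + ε) k b` of them (where `ε` is the coding
overhead, `b' = (1 + ε) b`), and recovers all information symbols. -/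
structure IsDecodingRun (C : ArrayCode n k b) (S : Finset (Fin n)) (l : List C.Symbol) : Prop where
  nodup : l.Nodup
  mem : ∀ s ∈ l, s.1 ∈ S
  length_le : (l.length : ℝ) ≤ k * C.avgSize
  peels : C.Peels ∅ l

/-- The code properties: `b' > b`, and the information symbols can be recovered by belief
propagation from any `k` of the `n` nodes. -/
structure IsBPXOR (C : ArrayCode n k b) : Prop where
  lt_avgSize : (b : ℝ) < C.avgSize
  decodable : ∀ S : Finset (Fin n), S.card = k → ∃ l, C.IsDecodingRun S l

/-- The worst-case number of operations of the decoder, over all sets of `k` nodes and all runs on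
them, when processing the coded symbol `s` costs `w s` operations. -/
noncomputable def decodingWork (C : ArrayCode n k b) (w : C.Symbol → ℕ) : ℕ :=
  sSup {W | ∃ S : Finset (Fin n), S.card = k ∧
    ∃ l, C.IsDecodingRun S l ∧ W = (l.map w).sum}

variable {Ω : Type*}

/-- The completion time of node `i`: all its processors have to finish. Processor `s` performs `w s`
dot products, and its running time is `w s` times the time `X s` of a single one. -/
noncomputable def nodeTime (C : ArrayCode n k b) (w : C.Symbol → ℕ) (X : C.Symbol → Ω → ℝ)
    (i : Fin n) (ω : Ω) : ℝ :=
  ⨆ j : Fin (C.size i), (w ⟨i, j⟩ : ℝ) * X ⟨i, j⟩ ω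

/-- The parallel task time `min_S max_{i ∈ S} T_i`, over all sets `S` of `k` nodes. -/
noncomputable def parallelTime (C : ArrayCode n k b) (w : C.Symbol → ℕ) (X : C.Symbol → Ω → ℝ)
    (ω : Ω) : ℝ :=
  ⨅ S : {S : Finset (Fin n) // S.card = k}, ⨆ i : {i : Fin n // i ∈ S.1}, C.nodeTime w X i.1 ω

/-- The decoding time: the work of the decoder is split evenly over the `p` processors of the
master, all of which have to finish; `Z j` is the time of a single operation on processor `j`. -/
noncomputable def decodingTime (C : ArrayCode n k b) (w : C.Symbol → ℕ) {p : ℕ}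
    (Z : Fin p → Ω → ℝ) (ω : Ω) : ℝ :=
  ⨆ j : Fin p, ((C.decodingWork w : ℝ) / p) * Z j ω

/-- The total computation time; encoding takes no dot products at the master. -/
noncomputable def latency (C : ArrayCode n k b) (w : C.Symbol → ℕ) (X : C.Symbol → Ω → ℝ) {p : ℕ}
    (Z : Fin p → Ω → ℝ) (ω : Ω) : ℝ :=
  C.parallelTime w X ω + C.decodingTime w Z ω

/-- `x_i = σ_i log b_i`. -/
noncomputable def logSize (C : ArrayCode n k b) (σ : Fin n → ℕ) (i : Fin n) : ℝ :=
  σ i * Real.log (C.size i)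

/-- `√(n (max x_i - min x_i)² / 4 + (1/n) ∑ b_i ^ (2 (σ_i - 1))) / μ`. -/
noncomputable def sigmaBar (C : ArrayCode n k b) (σ : Fin n → ℕ) (μ : ℝ) : ℝ :=
  (1 / μ) * Real.sqrt
    (n * ((⨆ i, C.logSize σ i) - ⨅ i, C.logSize σ i) ^ 2 / 4 +
      (1 / n) * ∑ i, (C.size i : ℝ) ^ (2 * ((σ i : ℝ) - 1)))

end ArrayCode

/-! Both expectations come from one device: a maximum or order statistic exceeds a level `t` by at
most a sum of excesses over `t`, and an exponential of rate `r` has mean excess `exp (-(r * u)) / r`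
over `u`. For decoding, the level `log p / r` costs an extra `1 / r`, which is small against `log p
/ r` for large `p`. For the parallel time, take the level `M / μ` with `M = max x_i`: each node has
mean excess at most `σ / μ`, and the `k`-th order statistic shares the total among `n - k` nodes,
giving `(M + a) / μ` with `a = σ (1 + δ) / δ` (`orderStatistic_le`, `integral_parallelTime_le`).

It remains to compare `M + a` with `μ B`. A node of at most average size gives `min x_i ≤ σ log b'`,
and the deviation term pays for the spread. Since any `k` nodes decode, every information symbol
occurs on at least `n - k` nodes; bounded degrees then force `b'` to grow with `k`
(`IsBPXOR.le_log_avgSize`). So `a` is at most `ε σ log b'`, and for `σ ≥ 2` it is absorbed with no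
loss (`iSup_logSize_add_le`). -/

/-! ### Exponential excesses -/

theorem measurable_exponentialPDF (r : ℝ) : Measurable (exponentialPDF r) :=
  (measurable_exponentialPDFReal r).ennreal_ofReal

/-- The mean excess of an exponential law over a level `u ≥ 0`. -/
theorem lintegral_excess_expMeasure {r u : ℝ} (hr : 0 < r) (hu : 0 ≤ u) :
    ∫⁻ y, ENNReal.ofReal (y - u) ∂(expMeasure r) = ENNReal.ofReal (Real.exp (-(r * u)) / r) := by
  -- Explicit antiderivative of excess times density; it vanishes at infinity and equals `-exp (-(r
  -- * u)) / r` at `u`.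
  have hderiv : ∀ y ∈ Set.Ici u, HasDerivAt (fun y => -((y - u + 1 / r) * Real.exp (-r * y)))
      (r * (y - u) * Real.exp (-r * y)) y := by
    intro y _
    have h1 : HasDerivAt (fun y => y - u + 1 / r) 1 y :=
      ((hasDerivAt_id y).sub_const u).add_const _
    have h2 : HasDerivAt (fun y => Real.exp (-r * y)) (Real.exp (-r * y) * (-r * 1)) y :=
      ((hasDerivAt_id y).const_mul (-r)).exp
    refine (h1.mul h2).neg.congr_deriv ?_
    have hrr : 1 / r * r = 1 := by field_simp
    linear_combination Real.exp (-r * y) * hrr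
  have hpos : ∀ y ∈ Set.Ioi u, 0 ≤ r * (y - u) * Real.exp (-r * y) := fun y hy => by
    have : 0 ≤ y - u := sub_nonneg.2 (le_of_lt hy)
    positivity
  have hlim : Filter.Tendsto (fun y => -((y - u + 1 / r) * Real.exp (-r * y))) Filter.atTop
      (nhds 0) := by
    have h1 := tendsto_rpow_mul_exp_neg_mul_atTop_nhds_zero 1 r hr
    have h0 := (tendsto_rpow_mul_exp_neg_mul_atTop_nhds_zero 0 r hr).const_mul (1 / r - u)
    have h := (h1.add h0).neg
    simp only [Real.rpow_one, Real.rpow_zero, one_mul, mul_zero, add_zero, neg_zero] at h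
    exact h.congr fun y => by ring
  have hint := integrableOn_Ioi_deriv_of_nonneg' hderiv hpos hlim
  have hval := integral_Ioi_of_hasDerivAt_of_nonneg' hderiv hpos hlim
  change ∫⁻ y, ENNReal.ofReal (y - u) ∂(volume.withDensity (exponentialPDF r)) = _
  rw [lintegral_withDensity_eq_lintegral_mul _
    (measurable_exponentialPDF r) (by fun_prop)]
  have hcongr : (exponentialPDF r * fun y => ENNReal.ofReal (y - u)) =
      (Set.Ioi u).indicator fun y => ENNReal.ofReal (r * (y - u) * Real.exp (-r * y)) := by
    ext y
    by_cases hy : u < y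
    · rw [Set.indicator_of_mem (by exact hy), Pi.mul_apply,
        exponentialPDF_of_nonneg (hu.trans hy.le), ← ENNReal.ofReal_mul (by positivity)]
      ring_nf
    · rw [Set.indicator_of_notMem (by exact hy), Pi.mul_apply,
        ENNReal.ofReal_of_nonpos (p := y - u) (by linarith), mul_zero]
  rw [hcongr, lintegral_indicator measurableSet_Ioi, ← ofReal_integral_eq_lintegral_ofReal hint
    ((ae_restrict_iff' measurableSet_Ioi).2 (ae_of_all _ hpos)), hval]
  congr 1
  rw [show -r * u = -(r * u) by ring]
  ring

theorem integral_excess_of_hasLaw_exponential {Ω : Type*} [MeasurableSpace Ω] {Pr : Measure Ω}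
    {X : Ω → ℝ} {r u : ℝ} (hr : 0 < r) (hu : 0 ≤ u) (hX : HasLaw X (expMeasure r) Pr) :
    Integrable (fun ω => max (X ω - u) 0) Pr ∧
      ∫ ω, max (X ω - u) 0 ∂Pr = Real.exp (-(r * u)) / r := by
  have hm : AEMeasurable (fun ω => max (X ω - u) 0) Pr := by
    have := hX.aemeasurable
    fun_prop
  have h0 : 0 ≤ᵐ[Pr] fun ω => max (X ω - u) 0 := ae_of_all _ fun ω => le_max_right _ _
  have hl : ∫⁻ ω, ENNReal.ofReal (max (X ω - u) 0) ∂Pr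
      = ENNReal.ofReal (Real.exp (-(r * u)) / r) := by
    rw [← lintegral_excess_expMeasure hr hu,
      ← hX.lintegral_comp (f := fun y => ENNReal.ofReal (y - u)) (by fun_prop)]
    exact lintegral_congr fun ω => by
      rcases le_total (X ω - u) 0 with h | h
      · rw [max_eq_right h, ENNReal.ofReal_of_nonpos h, ENNReal.ofReal_zero]
      · rw [max_eq_left h]
  refine ⟨⟨hm.aestronglyMeasurable, ?_⟩, ?_⟩
  · rw [hasFiniteIntegral_iff_ofReal h0, hl]
    exact ENNReal.ofReal_lt_top
  · rw [integral_eq_lintegral_of_nonneg_ae h0 hm.aestronglyMeasurable, hl,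
      ENNReal.toReal_ofReal (by positivity)]

theorem nonneg_of_hasLaw_exponential {Ω : Type*} [MeasurableSpace Ω] {Pr : Measure Ω}
    {X : Ω → ℝ} {r : ℝ} (hX : HasLaw X (expMeasure r) Pr) : ∀ᵐ ω ∂Pr, 0 ≤ X ω := by
  have h : ∀ᵐ y ∂(expMeasure r), 0 ≤ y := by
    change ∀ᵐ y ∂(volume.withDensity (exponentialPDF r)), 0 ≤ y
    rw [ae_withDensity_iff (measurable_exponentialPDF r)]
    exact ae_of_all _ fun y hy => not_lt.1 fun h => hy (exponentialPDF_of_neg h)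
  rw [← hX.map_eq] at h
  exact ae_of_ae_map hX.aemeasurable h

/-! ### Maxima and order statistics through excesses -/

theorem iSup_le_add_sum_excess {ι : Type*} [Fintype ι] (f : ι → ℝ) {t : ℝ} (ht : 0 ≤ t) :
    ⨆ i, f i ≤ t + ∑ i, max (f i - t) 0 := by
  have h0 : ∀ i ∈ Finset.univ, 0 ≤ max (f i - t) 0 := fun _ _ => le_max_right _ _
  refine Real.iSup_le (fun i => ?_) (add_nonneg ht (Finset.sum_nonneg h0))
  linarith [le_max_left (f i - t) 0, Finset.single_le_sum h0 (Finset.mem_univ i)]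

/-- The `k`-th smallest of `n` numbers, compared with the sum of the excesses over a level. -/
theorem orderStatistic_le {n k : ℕ} (hk : 0 < k) (hkn : k ≤ n) (f : Fin n → ℝ) (t : ℝ) :
    ((n : ℝ) - k) * ((⨅ S : {S : Finset (Fin n) // S.card = k}, ⨆ i : {i : Fin n // i ∈ S.1}, f i)
      - t) ≤ ∑ i, max (f i - t) 0 := by
  set m := ⨅ S : {S : Finset (Fin n) // S.card = k}, ⨆ i : {i : Fin n // i ∈ S.1}, f i with hm
  have h0 : ∀ i, 0 ≤ max (f i - t) 0 := fun _ => le_max_right _ _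
  have hkn' : (0 : ℝ) ≤ (n : ℝ) - k := sub_nonneg.2 (by exact_mod_cast hkn)
  rcases le_total m t with h | h
  · exact (mul_nonpos_of_nonneg_of_nonpos hkn' (by linarith)).trans
      (Finset.sum_nonneg fun i _ => h0 i)
  -- Fewer than `k` values lie strictly below `m`, since `k` of them would have a maximum below `m`.
  -- Hence at least `n - k` values each have excess at least `m - t`.
  set U := Finset.univ.filter fun i => f i < m with hU
  have hcard : U.card < k := by
    by_contra! hc
    obtain ⟨S, hSU, hS⟩ := Finset.exists_subset_card_eq hc
    have hne : S.Nonempty := Finset.card_pos.1 (by omega)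
    have : Nonempty {i : Fin n // i ∈ S} := hne.to_subtype
    obtain ⟨i, hi⟩ := exists_eq_ciSup_of_finite (f := fun i : {i : Fin n // i ∈ S} => f i)
    have h1 : m ≤ f i := by
      rw [hi]
      exact ciInf_le (Set.finite_range _).bddBelow (⟨S, hS⟩ : {S : Finset (Fin n) // S.card = k})
    exact absurd (Finset.mem_filter.1 (hSU i.2)).2 (not_lt.2 h1)
  have hc : (n : ℝ) - k ≤ (Finset.univ.filter fun i => ¬ f i < m).card := by
    have := Finset.card_filter_add_card_filter_not (s := (Finset.univ : Finset (Fin n)))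
      (fun i => f i < m)
    rw [Finset.card_univ, Fintype.card_fin, ← hU] at this
    rw [sub_le_iff_le_add]
    exact_mod_cast (by omega : n ≤ (Finset.univ.filter fun i => ¬ f i < m).card + k)
  calc ((n : ℝ) - k) * (m - t)
      ≤ (Finset.univ.filter fun i => ¬ f i < m).card * (m - t) :=
        mul_le_mul_of_nonneg_right hc (by linarith)
    _ = ∑ i ∈ Finset.univ.filter fun i => ¬ f i < m, (m - t) := by rw [Finset.sum_const, nsmul_eq_mul]
    _ ≤ ∑ i ∈ Finset.univ.filter fun i => ¬ f i < m, max (f i - t) 0 :=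
        Finset.sum_le_sum fun i hi => le_max_of_le_left (by
          have := not_lt.1 (Finset.mem_filter.1 hi).2
          linarith)
    _ ≤ _ := Finset.sum_le_sum_of_subset_of_nonneg (Finset.filter_subset _ _) fun i _ _ => h0 i

/-! ### Combinatorics of the code: decoding work and node sizes -/

namespace ArrayCode

variable {n k b : ℕ}

theorem Peels.mem_or_exists {C : ArrayCode n k b} {R : Finset (Fin (b * k))} {l : List C.Symbol}
    (h : C.Peels R l) (v : Fin (b * k)) : v ∈ R ∨ ∃ s ∈ l, v ∈ C.support s := by
  induction l generalizing R with
  | nil => exact Or.inl (by rw [show R = Finset.univ from h]; exact Finset.mem_univ v)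
  | cons s l ih =>
    rcases ih h.2 with h | ⟨s', hs', h⟩
    · rcases Finset.mem_union.1 h with h | h
      · exact Or.inl h
      · exact Or.inr ⟨s, List.mem_cons_self, h⟩
    · exact Or.inr ⟨s', List.mem_cons_of_mem _ hs', h⟩

/-- If every `k` nodes suffice for decoding, every information symbol is present on at least
`n - k` nodes. -/
theorem IsBPXOR.sub_le_card {C : ArrayCode n k b} (hC : C.IsBPXOR) (v : Fin (b * k)) :
    n - k ≤ (Finset.univ.filter fun s : C.Symbol => v ∈ C.support s).card := by
  classical
  -- `N` is the set of nodes holding `v`. If it were smaller than `n - k`, some `k` nodes would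
  -- avoid `v` and could not recover it.
  set N := (Finset.univ.filter fun s : C.Symbol => v ∈ C.support s).image Sigma.fst with hN
  refine le_trans ?_ (Finset.card_image_le (f := Sigma.fst))
  by_contra! hlt
  rw [← hN] at hlt
  have hc : k ≤ (Nᶜ).card := by
    rw [Finset.card_compl, Fintype.card_fin]
    omega
  obtain ⟨S, hSN, hS⟩ := Finset.exists_subset_card_eq hc
  obtain ⟨l, hl⟩ := hC.decodable S hS
  rcases hl.peels.mem_or_exists v with h | ⟨s, hs, h⟩
  · exact absurd h (Finset.notMem_empty v)
  · exact (Finset.mem_compl.1 (hSN (hl.mem s hs)))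
      (Finset.mem_image_of_mem _ (Finset.mem_filter.2 ⟨Finset.mem_univ s, h⟩))

/-- Double counting of the incidences between information symbols and coded symbols. -/
theorem IsBPXOR.mul_sub_le_sum_degree {C : ArrayCode n k b} (hC : C.IsBPXOR) :
    b * k * (n - k) ≤ ∑ s, C.degree s := by
  have h : ∑ s, C.degree s
      = ∑ v, (Finset.univ.filter fun s : C.Symbol => v ∈ C.support s).card := by
    simp only [degree, Finset.card_filter]
    rw [Finset.sum_comm]
    exact Finset.sum_congr rfl fun s _ => by simp
  rw [h]
  calc b * k * (n - k) = ∑ _v : Fin (b * k), (n - k) := by simp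
    _ ≤ _ := Finset.sum_le_sum fun v _ => hC.sub_le_card v

theorem sum_size (C : ArrayCode n k b) (hn : 0 < n) : ∑ i, (C.size i : ℝ) = n * C.avgSize := by
  have : (n : ℝ) ≠ 0 := by exact_mod_cast hn.ne'
  rw [avgSize]
  field_simp

/-- Symbols of bounded degree force the nodes to be large. -/
theorem IsBPXOR.mul_sub_le_mul_avgSize {C : ArrayCode n k b} (hC : C.IsBPXOR) (hn : 0 < n)
    (hkn : k ≤ n) {m : ℕ} (hm : ∀ s, C.degree s ≤ m) :
    (b * k * (n - k) : ℝ) ≤ m * (n * C.avgSize) := by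
  have h : b * k * (n - k) ≤ m * ∑ i, C.size i := by
    refine hC.mul_sub_le_sum_degree.trans ((Finset.sum_le_sum fun s _ => hm s).trans_eq ?_)
    simp [mul_comm]
  rw [← C.sum_size hn]
  have h' : ((b * k * (n - k) : ℕ) : ℝ) ≤ ((m * ∑ i, C.size i : ℕ) : ℝ) := by exact_mod_cast h
  push_cast [Nat.cast_sub hkn] at h'
  exact h'

theorem decodingWork_le (C : ArrayCode n k b) {w : C.Symbol → ℕ} {m : ℕ} (hw : ∀ s, w s ≤ m) :
    (C.decodingWork w : ℝ) ≤ m * (k * C.avgSize) := by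
  have h0 : 0 ≤ C.avgSize := by unfold avgSize; positivity
  -- The supremum is taken in `ℕ`, so it is compared with the floor; `csSup_le'` needs no
  -- nonemptiness.
  refine le_trans ?_ (Nat.floor_le (by positivity : (0 : ℝ) ≤ m * (k * C.avgSize)))
  refine Nat.cast_le.2 (csSup_le' ?_)
  rintro W ⟨S, -, l, hl, rfl⟩
  refine Nat.le_floor ?_
  have h1 : (l.map w).sum ≤ l.length * m := by
    have := List.sum_le_card_nsmul (l.map w) m fun x hx => by
      obtain ⟨s, -, rfl⟩ := List.mem_map.1 hx
      exact hw s
    simpa using this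
  calc ((l.map w).sum : ℝ) ≤ l.length * m := by exact_mod_cast h1
    _ ≤ k * C.avgSize * m := mul_le_mul_of_nonneg_right hl.length_le (by positivity)
    _ = _ := by ring

theorem exists_size_le_avgSize (C : ArrayCode n k b) (hn : 0 < n) :
    ∃ i, (C.size i : ℝ) ≤ C.avgSize := by
  have : Nonempty (Fin n) := ⟨⟨0, hn⟩⟩
  obtain ⟨i, -, hi⟩ := Finset.exists_le_of_sum_le (s := Finset.univ)
    (f := fun i => (C.size i : ℝ)) (g := fun _ => C.avgSize) Finset.univ_nonempty
    (by simp [C.sum_size hn])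
  exact ⟨i, hi⟩

theorem exists_avgSize_le_size (C : ArrayCode n k b) (hn : 0 < n) :
    ∃ i, C.avgSize ≤ (C.size i : ℝ) := by
  have : Nonempty (Fin n) := ⟨⟨0, hn⟩⟩
  obtain ⟨i, -, hi⟩ := Finset.exists_le_of_sum_le (s := Finset.univ)
    (f := fun _ => C.avgSize) (g := fun i => (C.size i : ℝ)) Finset.univ_nonempty
    (by simp [C.sum_size hn])
  exact ⟨i, hi⟩

theorem one_le_avgSize (C : ArrayCode n k b) (hn : 0 < n) (hsize : ∀ i, 1 ≤ C.size i) :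
    1 ≤ C.avgSize := by
  obtain ⟨i, hi⟩ := C.exists_size_le_avgSize hn
  exact le_trans (by exact_mod_cast hsize i) hi

/-! ### Comparing the extreme `x_i` with `log b'` and the deviation term -/

theorem logSize_le_iSup (C : ArrayCode n k b) (σ : Fin n → ℕ) (i : Fin n) :
    C.logSize σ i ≤ ⨆ i, C.logSize σ i :=
  le_ciSup (Set.finite_range _).bddAbove i

theorem iInf_le_logSize (C : ArrayCode n k b) (σ : Fin n → ℕ) (i : Fin n) :
    ⨅ i, C.logSize σ i ≤ C.logSize σ i :=
  ciInf_le (Set.finite_range _).bddBelow i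

theorem logSize_nonneg (C : ArrayCode n k b) (σ : Fin n → ℕ) (i : Fin n) : 0 ≤ C.logSize σ i :=
  mul_nonneg (Nat.cast_nonneg _) (Real.log_natCast_nonneg _)

theorem iInf_logSize_le (C : ArrayCode n k b) (hn : 0 < n) (hsize : ∀ i, 1 ≤ C.size i)
    {σ : Fin n → ℕ} {m : ℕ} (hm : ∀ i, σ i ≤ m) :
    ⨅ i, C.logSize σ i ≤ m * Real.log C.avgSize := by
  obtain ⟨i, hi⟩ := C.exists_size_le_avgSize hn
  have hpos : (0 : ℝ) < C.size i := by exact_mod_cast hsize i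
  exact (C.iInf_le_logSize σ i).trans (mul_le_mul (by exact_mod_cast hm i)
    (Real.log_le_log hpos hi) (Real.log_natCast_nonneg _) (Nat.cast_nonneg _))

theorem log_avgSize_le_iSup (C : ArrayCode n k b) (hn : 0 < n) (hsize : ∀ i, 1 ≤ C.size i)
    {σ : Fin n → ℕ} (hσ : ∀ i, 1 ≤ σ i) :
    Real.log C.avgSize ≤ ⨆ i, C.logSize σ i := by
  obtain ⟨i, hi⟩ := C.exists_avgSize_le_size hn
  refine le_trans ?_ (C.logSize_le_iSup σ i)
  calc Real.log C.avgSize ≤ 1 * Real.log (C.size i) := by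
        rw [one_mul]
        exact Real.log_le_log (zero_lt_one.trans_le (C.one_le_avgSize hn hsize)) hi
    _ ≤ σ i * Real.log (C.size i) :=
        mul_le_mul_of_nonneg_right (by exact_mod_cast hσ i) (Real.log_natCast_nonneg _)

/-- The average over `i` of `exp x_i = b_i ^ σ_i ≤ b_i + b_i ^ (2 (σ_i - 1))`: the first summand
suffices if `σ_i = 1`, the second if `σ_i ≥ 2`, as then `σ_i ≤ 2 (σ_i - 1)`. -/
theorem exp_iInf_logSize_le (C : ArrayCode n k b) (hn : 0 < n) (hsize : ∀ i, 1 ≤ C.size i)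
    {σ : Fin n → ℕ} (hσ : ∀ i, 1 ≤ σ i) :
    Real.exp (⨅ i, C.logSize σ i) ≤
      C.avgSize + (1 / n) * ∑ i, (C.size i : ℝ) ^ (2 * ((σ i : ℝ) - 1)) := by
  have hterm : ∀ i, Real.exp (⨅ i, C.logSize σ i)
      ≤ C.size i + (C.size i : ℝ) ^ (2 * ((σ i : ℝ) - 1)) := by
    intro i
    have hpos : (0 : ℝ) < C.size i := by exact_mod_cast hsize i
    refine (Real.exp_le_exp.2 (C.iInf_le_logSize σ i)).trans ?_
    rcases (hσ i).eq_or_lt with h | h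
    · rw [logSize, ← h, Nat.cast_one, one_mul, Real.exp_log hpos]
      exact le_add_of_nonneg_right (by positivity)
    · refine le_trans ?_ (le_add_of_nonneg_left hpos.le)
      rw [Real.rpow_def_of_pos hpos, logSize, mul_comm]
      have h2 : (2 : ℝ) ≤ σ i := by exact_mod_cast h
      exact Real.exp_le_exp.2
        (mul_le_mul_of_nonneg_left (by linarith) (Real.log_natCast_nonneg _))
  have hsum := Finset.sum_le_sum fun i (_ : i ∈ Finset.univ) => hterm i
  have hn' : (0 : ℝ) < n := by exact_mod_cast hn
  rw [Finset.sum_add_distrib, C.sum_size hn, Finset.sum_const, Finset.card_univ, Fintype.card_fin,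
    nsmul_eq_mul] at hsum
  refine le_of_mul_le_mul_left (hsum.trans_eq ?_) hn'
  field_simp

/-- The excess of the largest `x_i` over the smallest is controlled by the deviation term. -/
theorem mul_sub_le_sqrt_mul_sqrt {n : ℕ} {r q a L : ℝ} (hq : 0 ≤ q) (ha : 0 ≤ a)
    (h : 2 * a ^ 2 ≤ n * L) :
    a * r ≤ Real.sqrt (n * r ^ 2 / 4 + q) * Real.sqrt (2 * L) := by
  rw [← Real.sqrt_mul (by positivity)]
  rcases le_or_gt 0 L with hL | hL
  · refine Real.le_sqrt_of_sq_le ?_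
    nlinarith [mul_le_mul_of_nonneg_right h (sq_nonneg r), mul_nonneg hq hL]
  · have : n * L ≤ 0 := mul_nonpos_of_nonneg_of_nonpos (Nat.cast_nonneg _) hL.le
    have ha0 : a = 0 := by nlinarith
    rw [ha0, zero_mul]
    exact Real.sqrt_nonneg _

/-- The constant `a` is absorbed in one of three ways: by a spread of at least 1, by the slack
between `log b'` and `m log b'`, or by the power mean in the deviation term. -/
theorem iSup_logSize_add_le (C : ArrayCode n k b) (hn : 0 < n) (hsize : ∀ i, 1 ≤ C.size i)
    {σ : Fin n → ℕ} (hσ : ∀ i, 1 ≤ σ i) {m : ℕ} (hm : ∀ i, σ i ≤ m) (hm2 : 2 ≤ m) {a L : ℝ}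
    (ha : 0 ≤ a) (hL : 0 ≤ L) (h1 : a + 2 ≤ Real.log C.avgSize)
    (h2 : (1 + a) ^ 2 ≤ L * Real.log C.avgSize) (h3 : 2 * (1 + a) ^ 2 ≤ n * L) :
    (⨆ i, C.logSize σ i) + a ≤ m * Real.log C.avgSize + Real.sqrt
      (n * ((⨆ i, C.logSize σ i) - ⨅ i, C.logSize σ i) ^ 2 / 4 +
        (1 / n) * ∑ i, (C.size i : ℝ) ^ (2 * ((σ i : ℝ) - 1))) * Real.sqrt (2 * L) := by
  have hinf := C.iInf_logSize_le hn hsize hm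
  have hsup := C.log_avgSize_le_iSup hn hsize hσ
  have hexp := C.exp_iInf_logSize_le hn hsize hσ
  have hq : 0 ≤ (1 / (n : ℝ)) * ∑ i, (C.size i : ℝ) ^ (2 * ((σ i : ℝ) - 1)) := by positivity
  have havg := zero_lt_one.trans_le (C.one_le_avgSize hn hsize)
  have hm2' : (2 : ℝ) ≤ m := by exact_mod_cast hm2
  set M := ⨆ i, C.logSize σ i
  set I := ⨅ i, C.logSize σ i
  set q := (1 / (n : ℝ)) * ∑ i, (C.size i : ℝ) ^ (2 * ((σ i : ℝ) - 1))
  set l := Real.log C.avgSize with hl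
  -- For spread at least 1, `(M - I) + a ≤ (1 + a) (M - I)`, which the deviation term dominates.
  rcases le_or_gt 1 (M - I) with hr | hr
  · have := mul_sub_le_sqrt_mul_sqrt (n := n) (r := M - I) hq (by linarith : 0 ≤ 1 + a) h3
    nlinarith
  · have hml : 2 * l ≤ m * l := mul_le_mul_of_nonneg_right hm2' (by linarith)
    -- If `exp I ≤ 2 b'`, then `M + a ≤ log b' + log 2 + 1 + a ≤ 2 log b'`. Otherwise `exp I ≤ b' +
    -- q` gives `exp I ≤ 2 q`, so `q` is at least `log b' / 2`.
    rcases le_or_gt (Real.exp I / 2) C.avgSize with hb | hb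
    · have h4 := Real.log_le_log (by positivity) hb
      rw [Real.log_div (Real.exp_ne_zero _) two_ne_zero, Real.log_exp, ← hl] at h4
      have := Real.log_two_lt_d9
      have := mul_nonneg (Real.sqrt_nonneg (n * (M - I) ^ 2 / 4 + q)) (Real.sqrt_nonneg (2 * L))
      linarith
    · have h4 : l ≤ Real.exp I := by
        have := Real.add_one_le_exp (l - 1)
        have := Real.exp_le_exp.2 (by linarith : l - 1 ≤ I)
        linarith
      have h5 : 1 + a ≤ Real.sqrt (n * (M - I) ^ 2 / 4 + q) * Real.sqrt (2 * L) := by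
        rw [← Real.sqrt_mul (by positivity)]
        refine Real.le_sqrt_of_sq_le (h2.trans ?_)
        have h6 : l ≤ 2 * (n * (M - I) ^ 2 / 4 + q) := by
          have : 0 ≤ n * (M - I) ^ 2 / 4 := by positivity
          linarith
        nlinarith [mul_le_mul_of_nonneg_left h6 hL]
      linarith

theorem iSup_logSize_le (C : ArrayCode n k b) (hn : 0 < n) (hsize : ∀ i, 1 ≤ C.size i)
    {σ : Fin n → ℕ} {m : ℕ} (hm : ∀ i, σ i ≤ m) {L : ℝ} (h : 2 ≤ n * L) :
    (⨆ i, C.logSize σ i) ≤ m * Real.log C.avgSize + Real.sqrt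
      (n * ((⨆ i, C.logSize σ i) - ⨅ i, C.logSize σ i) ^ 2 / 4 +
        (1 / n) * ∑ i, (C.size i : ℝ) ^ (2 * ((σ i : ℝ) - 1))) * Real.sqrt (2 * L) := by
  have hinf := C.iInf_logSize_le hn hsize hm
  have := mul_sub_le_sqrt_mul_sqrt (n := n) (r := (⨆ i, C.logSize σ i) - ⨅ i, C.logSize σ i) (q := (1 / (n : ℝ)) *
    ∑ i, (C.size i : ℝ) ^ (2 * ((σ i : ℝ) - 1))) (by positivity) zero_le_one
    (by simpa using h)
  linarith

end ArrayCode

/-! ### Expected parallel and decoding times -/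

theorem integrable_and_integral_le_of_le {Ω : Type*} [MeasurableSpace Ω] {Pr : Measure Ω}
    {f g : Ω → ℝ} (hf : AEMeasurable f Pr) (h0 : ∀ᵐ ω ∂Pr, 0 ≤ f ω) (hfg : ∀ᵐ ω ∂Pr, f ω ≤ g ω)
    (hg : Integrable g Pr) : Integrable f Pr ∧ ∫ ω, f ω ∂Pr ≤ ∫ ω, g ω ∂Pr := by
  have hint : Integrable f Pr := hg.mono' hf.aestronglyMeasurable (by
    filter_upwards [h0, hfg] with ω h1 h2
    rwa [Real.norm_of_nonneg h1])
  exact ⟨hint, integral_mono_ae hint hg hfg⟩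

namespace ArrayCode

variable {n k b : ℕ}

theorem excess_nodeTime_le (C : ArrayCode n k b) {Ω : Type*} {σ : Fin n → ℕ} (hσ : ∀ i, 1 ≤ σ i)
    {w : C.Symbol → ℕ} (hw : ∀ s, w s ≤ σ s.1) {X : C.Symbol → Ω → ℝ} {ω : Ω}
    (hX : ∀ s, 0 ≤ X s ω) {t : ℝ} (ht : 0 ≤ t) (i : Fin n) :
    max (C.nodeTime w X i ω - t) 0 ≤ ∑ j, (σ i : ℝ) * max (X ⟨i, j⟩ ω - t / σ i) 0 := by
  have hnn : ∀ j ∈ Finset.univ, 0 ≤ (σ i : ℝ) * max (X ⟨i, j⟩ ω - t / σ i) 0 :=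
    fun j _ => mul_nonneg (Nat.cast_nonneg _) (le_max_right _ _)
  refine max_le ?_ (Finset.sum_nonneg hnn)
  rw [sub_le_iff_le_add]
  refine Real.iSup_le (fun j => ?_) (add_nonneg (Finset.sum_nonneg hnn) ht)
  have hpos : (0 : ℝ) < σ i := by exact_mod_cast hσ i
  have h1 : (w ⟨i, j⟩ : ℝ) * X ⟨i, j⟩ ω ≤ σ i * X ⟨i, j⟩ ω :=
    mul_le_mul_of_nonneg_right (by exact_mod_cast hw ⟨i, j⟩) (hX _)
  have h2 : (σ i : ℝ) * (X ⟨i, j⟩ ω - t / σ i) ≤ σ i * max (X ⟨i, j⟩ ω - t / σ i) 0 :=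
    mul_le_mul_of_nonneg_left (le_max_left _ _) hpos.le
  rw [mul_sub, mul_div_cancel₀ _ hpos.ne'] at h2
  have h3 := Finset.single_le_sum hnn (Finset.mem_univ j)
  linarith

theorem integral_parallelTime_le (C : ArrayCode n k b) (hk : 0 < k) (hkn : k < n)
    (hsize : ∀ i, 1 ≤ C.size i) {σ : Fin n → ℕ} (hσ : ∀ i, 1 ≤ σ i) {m : ℕ} (hm : ∀ i, σ i ≤ m)
    {w : C.Symbol → ℕ} (hw : ∀ s, w s ≤ σ s.1) {Ω : Type*} [MeasurableSpace Ω] {Pr : Measure Ω}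
    [IsProbabilityMeasure Pr] {μ : ℝ} (hμ : 0 < μ) {X : C.Symbol → Ω → ℝ}
    (hX : ∀ s, HasLaw (X s) (expMeasure μ) Pr) :
    Integrable (C.parallelTime w X) Pr ∧ ∫ ω, C.parallelTime w X ω ∂Pr ≤
      ((⨆ i, C.logSize σ i) + n / (n - k) * m) / μ := by
  set M := ⨆ i, C.logSize σ i with hM
  have hn : 0 < n := hk.trans hkn
  have hM0 : 0 ≤ M := (C.logSize_nonneg σ ⟨0, hn⟩).trans (C.logSize_le_iSup σ ⟨0, hn⟩)
  have ht : 0 ≤ M / μ := by positivity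
  have hnk : (0 : ℝ) < n - k := sub_pos.2 (by exact_mod_cast hkn)
  have hmeas : AEMeasurable (C.parallelTime w X) Pr := by
    unfold parallelTime nodeTime
    refine .iInf fun S => .iSup fun i => .iSup fun j => ?_
    exact (hX _).aemeasurable.const_mul _
  have hnn : ∀ᵐ ω ∂Pr, ∀ s, 0 ≤ X s ω := ae_all_iff.2 fun s => nonneg_of_hasLaw_exponential (hX s)
  have hex := fun s : C.Symbol =>
    integral_excess_of_hasLaw_exponential hμ (div_nonneg ht (Nat.cast_nonneg (σ s.1))) (hX s)
  have hint : ∀ i ∈ Finset.univ, Integrable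
      (fun ω => ∑ j, (σ i : ℝ) * max (X ⟨i, j⟩ ω - M / μ / σ i) 0) Pr := fun i _ =>
    integrable_finsetSum _ fun j _ => (hex ⟨i, j⟩).1.const_mul _
  have hint' := (integrable_const (M / μ)).add
    ((integrable_finsetSum Finset.univ hint).const_mul (1 / ((n : ℝ) - k)))
  obtain ⟨h1, h2⟩ := integrable_and_integral_le_of_le hmeas
    (hnn.mono fun ω hω => Real.iInf_nonneg fun S => Real.iSup_nonneg fun i =>
      Real.iSup_nonneg fun j => mul_nonneg (Nat.cast_nonneg _) (hω _))
    (hnn.mono fun ω hω => by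
      have h := (orderStatistic_le hk hkn.le (fun i => C.nodeTime w X i ω) (M / μ)).trans
        (Finset.sum_le_sum fun i _ => C.excess_nodeTime_le hσ hw hω ht i)
      rw [← le_div_iff₀' hnk] at h
      change C.parallelTime w X ω - M / μ ≤ _ at h
      rw [Pi.add_apply, one_div_mul_eq_div]
      linarith) hint'
  refine ⟨h1, h2.trans ?_⟩
  have hnode : ∀ i ∈ Finset.univ,
      ∑ j, ∫ ω, (σ i : ℝ) * max (X ⟨i, j⟩ ω - M / μ / σ i) 0 ∂Pr ≤ m / μ := by
    intro i _
    have hpos : (0 : ℝ) < σ i := by exact_mod_cast hσ i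
    have hb : (0 : ℝ) < C.size i := by exact_mod_cast hsize i
    -- The level `M / μ` is chosen for this: `M ≥ σ_i log b_i`, so the tail factor cancels the `b_i`
    -- processors of the node.
    have hexp : Real.exp (-(μ * (M / μ / σ i))) ≤ 1 / C.size i := by
      rw [one_div, ← Real.exp_log (inv_pos.2 hb), Real.log_inv]
      refine Real.exp_le_exp.2 (neg_le_neg ?_)
      rw [show μ * (M / μ / σ i) = M / σ i by field_simp, le_div_iff₀' hpos]
      exact C.logSize_le_iSup σ i
    simp only [integral_const_mul, (hex ⟨i, _⟩).2]
    rw [Finset.sum_const, Finset.card_univ, Fintype.card_fin, nsmul_eq_mul]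
    calc (C.size i : ℝ) * (σ i * (Real.exp (-(μ * (M / μ / σ i))) / μ))
        ≤ C.size i * (σ i * (1 / C.size i / μ)) := by gcongr
      _ = σ i / μ := by field_simp
      _ ≤ m / μ := div_le_div_of_nonneg_right (by exact_mod_cast hm i) hμ.le
  have hsum := Finset.sum_le_sum hnode
  rw [Finset.sum_const, Finset.card_univ, Fintype.card_fin, nsmul_eq_mul] at hsum
  simp only [Pi.add_apply]
  rw [integral_add (integrable_const _) ((integrable_finsetSum Finset.univ hint).const_mul _),
    integral_const, probReal_univ, one_smul, integral_const_mul, integral_finsetSum _ hint]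
  simp only [fun i => integral_finsetSum (μ := Pr) Finset.univ
    (fun (j : Fin (C.size i)) _ => (hex ⟨i, j⟩).1.const_mul (σ i : ℝ))]
  calc M / μ + 1 / ((n : ℝ) - k) * _ ≤ M / μ + 1 / ((n : ℝ) - k) * (n * (m / μ)) := by gcongr
    _ = _ := by field_simp

/-- At level `log p / r` the `p` mean excesses `1 / (p r)` add up to `1 / r`. -/
theorem integral_decodingTime_le (C : ArrayCode n k b) (w : C.Symbol → ℕ) {Ω : Type*}
    [MeasurableSpace Ω] {Pr : Measure Ω} [IsProbabilityMeasure Pr] {r : ℝ} (hr : 0 < r) {p : ℕ}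
    (hp : 0 < p) {Z : Fin p → Ω → ℝ} (hZ : ∀ j, HasLaw (Z j) (expMeasure r) Pr) :
    Integrable (C.decodingTime w Z) Pr ∧ ∫ ω, C.decodingTime w Z ω ∂Pr ≤
      (C.decodingWork w : ℝ) / p * ((Real.log p + 1) / r) := by
  have hp' : (0 : ℝ) < p := by exact_mod_cast hp
  have ht : 0 ≤ Real.log p / r := div_nonneg (Real.log_natCast_nonneg p) hr.le
  have hW : 0 ≤ (C.decodingWork w : ℝ) / p := by positivity
  have hmeas : AEMeasurable (C.decodingTime w Z) Pr := by
    unfold decodingTime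
    exact .iSup fun j => (hZ j).aemeasurable.const_mul _
  have hnn : ∀ᵐ ω ∂Pr, ∀ j, 0 ≤ Z j ω := ae_all_iff.2 fun j => nonneg_of_hasLaw_exponential (hZ j)
  have hex := fun j => integral_excess_of_hasLaw_exponential hr ht (hZ j)
  have hint := integrable_finsetSum Finset.univ fun j _ => (hex j).1
  have hint' := ((integrable_const (Real.log p / r)).add hint).const_mul
    ((C.decodingWork w : ℝ) / p)
  obtain ⟨h1, h2⟩ := integrable_and_integral_le_of_le hmeas
    (hnn.mono fun ω hω => Real.iSup_nonneg fun j => mul_nonneg hW (hω j))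
    (ae_of_all _ fun ω => by
      unfold decodingTime
      rw [← Real.mul_iSup_of_nonneg hW]
      exact mul_le_mul_of_nonneg_left (iSup_le_add_sum_excess (fun j => Z j ω) ht) hW) hint'
  refine ⟨h1, h2.trans_eq ?_⟩
  simp only [Pi.add_apply]
  rw [integral_const_mul, integral_add (integrable_const _) hint,
    integral_const, probReal_univ, one_smul, integral_finsetSum _ fun j _ => (hex j).1]
  simp only [(hex _).2]
  rw [Finset.sum_const, Finset.card_univ, Fintype.card_fin, nsmul_eq_mul,
    mul_div_cancel₀ _ hr.ne', Real.exp_neg, Real.exp_log hp']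
  field_simp

theorem integral_decodingTime_le_of_log (C : ArrayCode n k b) {w : C.Symbol → ℕ} {m : ℕ}
    (hw : ∀ s, w s ≤ m) {Ω : Type*} [MeasurableSpace Ω] {Pr : Measure Ω} [IsProbabilityMeasure Pr]
    {c μ : ℝ} (hc : 0 < c) (hμ : 0 < μ) {p : ℕ} (hp : 0 < p) {ε : ℝ}
    (hlog : 1 ≤ ε * Real.log p) {Z : Fin p → Ω → ℝ}
    (hZ : ∀ j, HasLaw (Z j) (expMeasure (c * μ)) Pr) :
    Integrable (C.decodingTime w Z) Pr ∧ ∫ ω, C.decodingTime w Z ω ∂Pr ≤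
      (1 + ε) * (m * k * C.avgSize / (c * p * μ) * Real.log p) := by
  obtain ⟨h1, h2⟩ := C.integral_decodingTime_le w (mul_pos hc hμ) hp hZ
  refine ⟨h1, h2.trans ?_⟩
  have hp' : (0 : ℝ) < p := by exact_mod_cast hp
  have h0 : 0 ≤ C.avgSize := by unfold avgSize; positivity
  have hlog0 : 0 ≤ Real.log p := Real.log_natCast_nonneg p
  calc (C.decodingWork w : ℝ) / p * ((Real.log p + 1) / (c * μ))
      ≤ m * (k * C.avgSize) / p * (((1 + ε) * Real.log p) / (c * μ)) := by
        gcongr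
        · exact C.decodingWork_le hw
        · linarith
    _ = _ := by field_simp

/-- With bounded degrees, the logarithm of the average node size exceeds any constant once `k` is
large. -/
theorem IsBPXOR.le_log_avgSize {C : ArrayCode n k b} (hC : C.IsBPXOR) (hb : 0 < b) (hk : 0 < k)
    {δ : ℝ} (hδ : 0 < δ) (hn : (n : ℝ) = (1 + δ) * k) {m : ℕ} (hm : ∀ s, C.degree s ≤ m) {y : ℝ}
    (hy : Real.exp y * (m * (1 + δ)) ≤ δ * k) : y ≤ Real.log C.avgSize := by
  have hk' : (0 : ℝ) < k := by exact_mod_cast hk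
  have hb' : (1 : ℝ) ≤ b := by exact_mod_cast hb
  have hkn : k ≤ n := by
    have : (k : ℝ) ≤ n := by rw [hn]; nlinarith
    exact_mod_cast this
  have h := hC.mul_sub_le_mul_avgSize (hk.trans_le hkn) hkn hm
  rw [hn] at h
  have h1 : δ * k ≤ m * (1 + δ) * C.avgSize := by
    have h2 : k * (b * (δ * k)) ≤ k * (m * (1 + δ) * C.avgSize) := by linarith
    have h3 := le_of_mul_le_mul_left h2 hk'
    have h4 : 0 ≤ δ * k := by positivity
    nlinarith
  have hpos : 0 < (m : ℝ) * (1 + δ) := by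
    rcases Nat.eq_zero_or_pos m with rfl | hm0
    · rw [Nat.cast_zero, zero_mul, zero_mul] at h1
      exact absurd h1 (not_le.2 (by positivity))
    · have : (0 : ℝ) < m := by exact_mod_cast hm0
      positivity
  have h5 : Real.exp y ≤ C.avgSize := by
    refine le_of_mul_le_mul_left ?_ hpos
    linarith
  exact (Real.le_log_iff_exp_le ((Real.exp_pos y).trans_le h5)).2 h5

end ArrayCode

/-! ### Choice of thresholds and conclusion -/

theorem theorem4 :
    ∀ ε : ℝ, 0 < ε → ∃ P : ℕ, ∀ (δ : ℝ) (σmax : ℕ), 0 < δ → ∃ K : ℕ,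
      ∀ (k n b p : ℕ) (c μ : ℝ), K ≤ k → (n : ℝ) = (1 + δ) * k → 0 < b → P ≤ p → 0 < c → 0 < μ →
      ∀ (C : ArrayCode n k b), C.IsBPXOR → (∀ i, 1 ≤ C.size i) →
      ∀ (σ : Fin n → ℕ), (∀ i, 1 ≤ σ i) → IsGreatest (Set.range σ) σmax →
      ∀ (w : C.Symbol → ℕ), (∀ s, C.degree s ≤ w s ∧ w s ≤ σ s.1) →
      ∀ (Ω : Type*) [MeasurableSpace Ω] (Pr : Measure Ω) [IsProbabilityMeasure Pr]
        (X : C.Symbol → Ω → ℝ) (Z : Fin p → Ω → ℝ),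
        (∀ s, HasLaw (X s) (expMeasure μ) Pr) → iIndepFun X Pr →
        (∀ j, HasLaw (Z j) (expMeasure (c * μ)) Pr) → iIndepFun Z Pr →
        Integrable (C.latency w X Z) Pr ∧
        ∫ ω, C.latency w X Z ω ∂Pr ≤
          (1 + ε) *
            (σmax * k * C.avgSize / (c * p * μ) * Real.log p
              + σmax / μ * Real.log C.avgSize
              + C.sigmaBar σ μ * Real.sqrt (2 * Real.log ((1 + δ) / δ))) ∧
        (2 ≤ σmax →
          ∫ ω, C.latency w X Z ω ∂Pr ≤
            (1 + ε) * (σmax * k * C.avgSize / (c * p * μ) * Real.log p)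
              + σmax / μ * Real.log C.avgSize
              + C.sigmaBar σ μ * Real.sqrt (2 * Real.log ((1 + δ) / δ))) := by
  intro ε hε
  -- This `P` gives `1 ≤ ε log p`.
  refine ⟨⌈Real.exp (1 / ε)⌉₊, fun δ σmax hδ => ?_⟩
  set L := Real.log ((1 + δ) / δ) with hLdef
  have hL : 0 < L := Real.log_pos (by rw [lt_div_iff₀ hδ]; linarith)
  set a : ℝ := (1 + δ) / δ * σmax with hadef
  have ha : 0 ≤ a := by positivity
  -- The three summands serve `a + 2 ≤ log b'`, `(1 + a) ^ 2 ≤ L log b'` and `a ≤ ε log b'`.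
  set y : ℝ := (a + 2) + (1 + a) ^ 2 / L + a / ε with hy
  -- The summands ensure `k ≥ 1`, `2 (1 + a) ^ 2 ≤ n L` and `y ≤ log b'`.
  refine ⟨⌈1 + 2 * (1 + a) ^ 2 / L + Real.exp y * (σmax * (1 + δ)) / δ⌉₊, ?_⟩
  intro k n b p c μ hK hn hb hP hc hμ C hC hsize σ hσ hσmax w hw Ω _ Pr _ X Z hX _ hZ _
  have hKk := (Nat.le_ceil _).trans (Nat.cast_le (α := ℝ).2 hK)
  have hq1 : 0 ≤ 2 * (1 + a) ^ 2 / L := by positivity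
  have hq2 : 0 ≤ Real.exp y * (σmax * (1 + δ)) / δ := by positivity
  have hk1 : (1 : ℝ) ≤ k := by linarith
  have hk : 0 < k := by exact_mod_cast zero_lt_one.trans_le hk1
  have hkn : k < n := by
    have : (k : ℝ) < n := by rw [hn]; nlinarith
    exact_mod_cast this
  have hpexp := (Nat.le_ceil _).trans (Nat.cast_le (α := ℝ).2 hP)
  have hp' : (0 : ℝ) < p := (Real.exp_pos _).trans_le hpexp
  have hp : 0 < p := by exact_mod_cast hp'
  have hlogp : 1 ≤ ε * Real.log p := by
    rw [← div_le_iff₀' hε]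
    exact (Real.le_log_iff_exp_le hp').2 hpexp
  have hm : ∀ i, σ i ≤ σmax := fun i => hσmax.2 ⟨i, rfl⟩
  have hσ1 : 1 ≤ σmax := (hσ ⟨0, hk.trans hkn⟩).trans (hm _)
  have hyl : y ≤ Real.log C.avgSize :=
    hC.le_log_avgSize hb hk hδ hn (fun s => ((hw s).1.trans (hw s).2).trans (hm _)) (by
      rw [← div_le_iff₀' hδ]
      linarith)
  have hy1 : 0 ≤ (1 + a) ^ 2 / L := by positivity
  have hy2 : 0 ≤ a / ε := by positivity
  have hnL : 2 * (1 + a) ^ 2 ≤ n * L := by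
    rw [← div_le_iff₀ hL]
    have : (k : ℝ) ≤ n := by exact_mod_cast hkn.le
    linarith
  obtain ⟨hpi, hpl⟩ := C.integral_parallelTime_le hk hkn hsize hσ hm (fun s => (hw s).2) hμ hX
  obtain ⟨hdi, hdl⟩ := C.integral_decodingTime_le_of_log (w := w)
    (fun s => (hw s).2.trans (hm _)) hc hμ hp hlogp hZ
  have hna : (n : ℝ) / (n - k) * σmax = a := by
    rw [hadef, hn]
    congr 1
    have : (k : ℝ) ≠ 0 := by positivity
    rw [show (1 + δ) * (k : ℝ) - k = δ * k by ring]
    field_simp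
  rw [hna] at hpl
  have hlat : ∫ ω, C.latency w X Z ω ∂Pr
      = ∫ ω, C.parallelTime w X ω ∂Pr + ∫ ω, C.decodingTime w Z ω ∂Pr := integral_add hpi hdi
  have hl0 : 0 ≤ Real.log C.avgSize := by linarith
  have hsharp : 2 ≤ σmax → ((⨆ i, C.logSize σ i) + a) / μ ≤
      σmax / μ * Real.log C.avgSize + C.sigmaBar σ μ * Real.sqrt (2 * L) := by
    intro h2
    have h := C.iSup_logSize_add_le (hk.trans hkn) hsize hσ hm h2 ha hL.le (by linarith)
      (by rw [← div_le_iff₀' hL]; linarith) hnL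
    refine (div_le_div_of_nonneg_right h hμ.le).trans_eq ?_
    rw [ArrayCode.sigmaBar]
    ring
  have hbar : 0 ≤ C.sigmaBar σ μ * Real.sqrt (2 * L) := by
    unfold ArrayCode.sigmaBar
    positivity
  have hloose : ((⨆ i, C.logSize σ i) + a) / μ ≤
      (1 + ε) * (σmax / μ * Real.log C.avgSize + C.sigmaBar σ μ * Real.sqrt (2 * L)) := by
    have h := C.iSup_logSize_le (hk.trans hkn) hsize hm (L := L) (by nlinarith)
    have h' := div_le_div_of_nonneg_right h hμ.le
    have hal : a / μ ≤ ε * (σmax / μ * Real.log C.avgSize) := by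
      have h3 : a ≤ ε * Real.log C.avgSize := by
        rw [← div_le_iff₀' hε]
        linarith
      have h4 : (1 : ℝ) ≤ σmax := by exact_mod_cast hσ1
      calc a / μ ≤ (ε * (σmax * Real.log C.avgSize)) / μ := by
            gcongr
            nlinarith
        _ = _ := by ring
    have hbar' := mul_nonneg hε.le hbar
    rw [ArrayCode.sigmaBar] at hbar' ⊢
    rw [add_div]
    refine (add_le_add h' hal).trans ?_
    refine le_of_sub_nonneg (hbar'.trans_eq ?_)
    ring
  refine ⟨hpi.add hdi, ?_, fun h2 => ?_⟩
  · rw [hlat]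
    linarith
  · rw [hlat]
    linarith [hsharp h2]
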